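/- Let $H(\mathbb{U})$ be the space of analytic functions on the open unit disk $\mathbb{U}$, and for $1\le p\le\infty$ let $H_p$ be the Hardy space of all $f\in H(\mathbb{U})$ with $\|f\|_{H_p}=\sup_{0\le r<1}\|f_r\|_{L_p}<\infty$, where $f_r(t)=f(re^{it})$ and $L_p$ is taken over $[0,2\pi]$ with the measure $dt/2\pi$. A Banach sequence lattice is a Banach space $E$ of complex sequences on $\mathbb{Z}_+$ such that, whenever $\{x_n\}\in E$ and $|y_n|\le|x_n|$ for all $n$, one has $\{y_n\}\in E$ and $\|\{y_n\}\|_E\le\|\{x_n\}\|_E$. The solid hull of a set $F$ of complex sequences is the smallest Banach sequence lattice containing $F$ (a Banach sequence lattice, unique up to an equivalent norm, that contains $F$ and is continuously included in every Banach sequence lattice containing $F$). Let $X$ be a complex Banach space of analytic functions on $\mathbb{U}$ (a linear subspace of $H(\mathbb{U})$ with a complete norm) such that $H_\infty\hookrightarrow X\hookrightarrow H_2$, where $\hookrightarrow$ denotes continuous inclusion. Then the solid hull of the space $\widehat X=\{\{\hat f(n)\}_{n\ge0} : f\in X\}$ of Taylor coefficient sequences, $f(z)=\sum_{n\ge0}\hat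 f(n)z^n$, is $\ell_2$. -/

import Mathlib

open scoped ENNReal NNReal

noncomputable section

/-- `H(𝕌)`: the analytic functions on the open unit disk `𝕌`. A function on `𝕌` is represented by
its extension by zero to `ℂ`, so that two elements are equal iff they agree on `𝕌`. -/
def HolDisk : Submodule ℂ (ℂ → ℂ) where
  carrier := {f | DifferentiableOn ℂ f (Metric.ball 0 1) ∧ ∀ z ∉ Metric.ball (0 : ℂ) 1, f z = 0}
  zero_mem' := ⟨differentiableOn_const 0, fun _ _ => rfl⟩
  add_mem' := fun hf hg =>
    ⟨hf.1.add hg.1, fun z hz => by simp [hf.2 z hz, hg.2 z hz]⟩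
  smul_mem' := fun c _ hf =>
    ⟨hf.1.const_smul c, fun z hz => by simp [hf.2 z hz]⟩

/-- The sequence of Taylor coefficients of `f` at the origin. -/
def taylorCoeff (f : HolDisk) (n : ℕ) : ℂ :=
  iteratedDeriv n (f : ℂ → ℂ) 0 / (n.factorial : ℂ)

/-- The space of the Taylor coefficient sequences of all functions in `G`. -/
def coeffSpace (G : Submodule ℂ HolDisk) : Set (ℕ → ℂ) :=
  taylorCoeff '' (G : Set HolDisk)

/-- The normalized Lebesgue measure `dt / 2π` on `[0, 2π]`. -/
def circleMeasure : MeasureTheory.Measure ℝ :=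
  ENNReal.ofReal (2 * Real.pi)⁻¹ • MeasureTheory.volume.restrict (Set.Icc 0 (2 * Real.pi))

/-- The Hardy norm `sup_{0 ≤ r < 1} ‖f_r‖_{L_p}`, `f_r(t) = f(r e^{it})`, with values in
`[0, ∞]`. -/
def hardyNorm (p : ℝ≥0∞) (f : HolDisk) : ℝ≥0∞ :=
  ⨆ r ∈ Set.Ico (0 : ℝ) 1,
    MeasureTheory.eLpNorm
      (fun t : ℝ => (f : ℂ → ℂ) ((r : ℂ) * Complex.exp ((t : ℂ) * Complex.I))) p circleMeasure

/-- Membership in the Hardy space `H_p`. -/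
def MemHardy (p : ℝ≥0∞) (f : HolDisk) : Prop :=
  hardyNorm p f < ∞

section Inclusions

variable {X : Type*} [NormedAddCommGroup X] [NormedSpace ℂ X]

/-- `H_p ↪ X`, for a normed space `X` realized as a space of analytic functions by `ι`:
every function in `H_p` belongs to `X`, and the inclusion is bounded. -/
def HardyEmbedsInto (p : ℝ≥0∞) (ι : X →ₗ[ℂ] HolDisk) : Prop :=
  ∃ C : ℝ≥0, ∀ f : HolDisk, MemHardy p f → ∃ x : X, ι x = f ∧ ‖x‖ₑ ≤ C * hardyNorm p f

/-- `X ↪ H_p`, for a normed space `X` realized as a space of analytic functions by `ι`: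
every function in `X` belongs to `H_p`, and the inclusion is bounded. -/
def EmbedsIntoHardy (p : ℝ≥0∞) (ι : X →ₗ[ℂ] HolDisk) : Prop :=
  ∃ C : ℝ≥0, ∀ x : X, MemHardy p (ι x) ∧ hardyNorm p (ι x) ≤ C * ‖x‖ₑ

end Inclusions

/-- A Banach sequence lattice on `ℕ`: a Banach space of complex sequences (a Banach space `E`
with an injective linear map `toSeq` to the sequences) that is an ideal with monotone norm. -/
structure BanachSequenceLattice where
  E : Type
  [normedAddCommGroup : NormedAddCommGroup E]
  [normedSpace : NormedSpace ℂ E]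
  [completeSpace : CompleteSpace E]
  toSeq : E →ₗ[ℂ] (ℕ → ℂ)
  toSeq_injective : Function.Injective toSeq
  ideal : ∀ (x : E) (y : ℕ → ℂ), (∀ n, ‖y n‖ ≤ ‖toSeq x n‖) → ∃ y' : E, toSeq y' = y ∧ ‖y'‖ ≤ ‖x‖

namespace BanachSequenceLattice

attribute [instance] normedAddCommGroup normedSpace completeSpace

/-- The set of sequences that belong to the lattice. -/
def seqs (S : BanachSequenceLattice) : Set (ℕ → ℂ) :=
  Set.range S.toSeq

/-- Continuous inclusion `S ↪ T` between Banach sequence lattices. -/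
def EmbedsInto (S T : BanachSequenceLattice) : Prop :=
  ∃ C : ℝ≥0, ∀ x : S.E, ∃ y : T.E, T.toSeq y = S.toSeq x ∧ ‖y‖ ≤ C * ‖x‖

/-- `S` is the solid hull of `F`: the smallest Banach sequence lattice that contains `F`.
(An inclusion between Banach sequence lattices is automatically continuous, by the closed graph
theorem, so `S` is determined up to an equivalent norm.) -/
def IsSolidHull (S : BanachSequenceLattice) (F : Set (ℕ → ℂ)) : Prop :=
  F ⊆ S.seqs ∧ ∀ T : BanachSequenceLattice, F ⊆ T.seqs → S.EmbedsInto T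

/-- `ℓ_2` with its usual norm. -/
def ellTwo : BanachSequenceLattice where
  E := lp (fun _ : ℕ => ℂ) 2
  toSeq :=
    { toFun := fun x n => x n
      map_add' := fun _ _ => rfl
      map_smul' := fun _ _ => rfl }
  toSeq_injective := fun _ _ h => lp.ext h
  ideal := by
    intro x y h
    have h2 : (0 : ℝ) < (2 : ℝ≥0∞).toReal := by norm_num
    have hx : Summable fun n => ‖x n‖ ^ (2 : ℝ≥0∞).toReal := (lp.memℓp x).summable h2
    have hle : ∀ n, ‖y n‖ ^ (2 : ℝ≥0∞).toReal ≤ ‖x n‖ ^ (2 : ℝ≥0∞).toReal := fun n =>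
      Real.rpow_le_rpow (norm_nonneg _) (h n) h2.le
    have hy : Summable fun n => ‖y n‖ ^ (2 : ℝ≥0∞).toReal :=
      Summable.of_nonneg_of_le (fun n => by positivity) hle hx
    refine ⟨⟨y, memℓp_gen hy⟩, rfl, ?_⟩
    rw [lp.norm_eq_tsum_rpow h2, lp.norm_eq_tsum_rpow h2]
    exact Real.rpow_le_rpow (tsum_nonneg fun n => by positivity) (hy.tsum_le_tsum hle hx)
      (by norm_num)

end BanachSequenceLattice

end

/-! That `ℓ_2` contains the coefficient sequences is Bessel's inequality on circles of radius `r <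
1`. Conversely, let a lattice `T` contain them. The closed graph theorem makes `X → T` bounded, so
the coefficients of `f ∈ H_∞` have `T`-norm at most `C ‖f‖_∞`. It remains to see that this alone
forces `ℓ_2 ↪ T`.

By duality (`norm_sum_smul_single_le`) it suffices to bound `∑ |φ(e_n)|²` for functionals `φ` in the
unit ball of the dual of `T`. Solidity allows the signs of coefficients to be changed freely. Signs
are chosen so that the polynomial `G` with coefficients `± conj φ(e_n)` has `L⁴`-norm comparable to
its `L²`-norm (`exists_signs_circleAverage_norm_pow_four_le`). Then `G / (1 + ε q)`, with `Re q =
|G|²` on the circle, is bounded by a multiple of `‖G‖₂` and still has inner product at least `‖G‖₂²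
/ 2` with `G` (`exists_bounded_analytic_correlated`). Testing `φ` on its sign-changed, truncated
coefficients gives the bound. -/

open scoped ComplexConjugate

/-! ### Fourier coefficients, Parseval and Bessel on the unit circle -/

/-- Cauchy's formula for the Taylor coefficients, as an average over a circle. -/
theorem circleAverage_div_pow {f : ℂ → ℂ} {R : ℝ} (hR : 0 < R)
    (hf : DiffContOnCl ℂ f (Metric.ball 0 R)) (n : ℕ) :
    Real.circleAverage (fun z => f z / z ^ n) 0 R = iteratedDeriv n f 0 / (n.factorial : ℂ) := by
  have h := hf.circleIntegral_one_div_sub_center_pow_smul hR n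
  rw [Real.circleAverage_eq_circleIntegral hR.ne']
  have h2 : (fun z : ℂ => (z - 0)⁻¹ • (f z / z ^ n)) =
      fun z => (1 / (z - 0) ^ (n + 1)) • f z := by
    ext z
    simp only [sub_zero, smul_eq_mul, pow_succ, div_eq_mul_inv, mul_inv, one_mul]
    ring
  rw [h2, h]
  have := Complex.two_pi_I_ne_zero
  simp only [smul_eq_mul]
  field_simp

theorem conj_pow_eq_inv_pow {z : ℂ} (hz : ‖z‖ = 1) (n : ℕ) : conj z ^ n = (z ^ n)⁻¹ := by
  rw [← Complex.inv_eq_conj hz, inv_pow]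

/-- The dilation of `f` has Fourier coefficients `rⁿ f̂(n)`. -/
theorem circleAverage_dilation_mul_conj_pow {f : ℂ → ℂ} {r : ℝ} (hr : 0 < r)
    (hf : DiffContOnCl ℂ f (Metric.ball 0 r)) (n : ℕ) :
    Real.circleAverage (fun z => f (r * z) * conj z ^ n) 0 1 =
      r ^ n * (iteratedDeriv n f 0 / (n.factorial : ℂ)) := by
  rw [← circleAverage_div_pow hr hf,
    Real.circleAverage_eq_circleAverage_zero_one (f := fun z => f z / z ^ n) (R := r),
    ← smul_eq_mul ((r : ℂ) ^ n), ← Real.circleAverage_fun_smul]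
  refine Real.circleAverage_congr_sphere (E := ℂ) (R := 1) fun z hz => ?_
  have hz1 : ‖z‖ = 1 := by simpa using hz
  have hz0 : z ≠ 0 := by rintro rfl; simp at hz1
  have hr0 : (r : ℂ) ≠ 0 := by exact_mod_cast hr.ne'
  simp only [conj_pow_eq_inv_pow hz1, add_zero, smul_eq_mul, mul_pow]
  field_simp

/-- The squared modulus of a polynomial on the unit circle is the real part of an entire
function with real value at the origin. -/
theorem exists_entire_re_eq_normSq (a : ℕ → ℂ) (N : ℕ) :
    ∃ q : ℂ → ℂ, Differentiable ℂ q ∧ q 0 = ((∑ n ∈ Finset.range N, ‖a n‖ ^ 2 : ℝ) : ℂ) ∧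
      ∀ z : ℂ, ‖z‖ = 1 → (q z).re = ‖∑ n ∈ Finset.range N, a n * z ^ n‖ ^ 2 := by
  induction N with
  | zero => exact ⟨fun _ => 0, by fun_prop, by simp, by simp⟩
  | succ N ih =>
    obtain ⟨q, hq, hq0, hqre⟩ := ih
    -- The cross term of `|A + B|²` is `2 Re (B conj A)`. On the circle `conj z ^ n * z ^ N = z ^ (N
    -- - n)`, so it is the real part of a polynomial; `n < N` makes that polynomial vanish at `0`.
    refine ⟨fun z => q z + (‖a N‖ ^ 2 : ℝ) +
      2 * (a N * ∑ n ∈ Finset.range N, conj (a n) * z ^ (N - n)), by fun_prop, ?_, ?_⟩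
    · beta_reduce
      have h0 : ∑ n ∈ Finset.range N, conj (a n) * (0 : ℂ) ^ (N - n) = 0 := by
        refine Finset.sum_eq_zero fun n hn => ?_
        have : N - n ≠ 0 := by have := Finset.mem_range.1 hn; omega
        simp [this]
      rw [hq0, Finset.sum_range_succ, h0]
      push_cast
      ring
    · intro z hz
      have hz0 : z ≠ 0 := by rintro rfl; simp at hz
      have h1 : ∑ n ∈ Finset.range N, conj (a n) * z ^ (N - n) =
          conj (∑ n ∈ Finset.range N, a n * z ^ n) * z ^ N := by
        rw [map_sum, Finset.sum_mul]
        refine Finset.sum_congr rfl fun n hn => ?_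
        rw [map_mul, map_pow, conj_pow_eq_inv_pow hz, pow_sub₀ _ hz0 (Finset.mem_range.1 hn).le]
        ring
      beta_reduce
      rw [Finset.sum_range_succ, h1]
      set A := ∑ n ∈ Finset.range N, a n * z ^ n
      have h2 : ‖a N * z ^ N‖ ^ 2 = ‖a N‖ ^ 2 := by simp [hz]
      have h3 := Complex.normSq_add A (a N * z ^ N)
      simp only [Complex.normSq_eq_norm_sq] at h3
      have h4 : (2 * (a N * (conj A * z ^ N))).re = 2 * (A * conj (a N * z ^ N)).re := by
        rw [← Complex.conj_re (A * _), show (2 * (a N * (conj A * z ^ N)) : ℂ) =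
          ((2 : ℝ) : ℂ) * conj (A * conj (a N * z ^ N)) by
            simp only [map_mul, Complex.conj_conj]; push_cast; ring, Complex.re_ofReal_mul]
      rw [h3, h2, ← hqre z hz, Complex.add_re, Complex.add_re, Complex.ofReal_re, h4]

theorem circleIntegrable_of_continuousOn_sphere {E : Type*} [NormedAddCommGroup E] {f : ℂ → E}
    (hf : ContinuousOn f (Metric.sphere 0 1)) : CircleIntegrable f 0 1 :=
  hf.circleIntegrable zero_le_one

/-- The real part of an entire function has the mean value property. -/
theorem circleAverage_re_of_differentiable {q : ℂ → ℂ} (hq : Differentiable ℂ q) :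
    Real.circleAverage (fun z => (q z).re) 0 1 = (q 0).re := by
  rw [← hq.diffContOnCl.circleAverage (c := 0) (R := 1)]
  exact Complex.reCLM.circleAverage_comp_comm
    (circleIntegrable_of_continuousOn_sphere hq.continuous.continuousOn)

/-- Parseval's identity for polynomials. -/
theorem circleAverage_norm_sq_polynomial (a : ℕ → ℂ) (N : ℕ) :
    Real.circleAverage (fun z => ‖∑ n ∈ Finset.range N, a n * z ^ n‖ ^ 2) 0 1 =
      ∑ n ∈ Finset.range N, ‖a n‖ ^ 2 := by
  obtain ⟨q, hq, hq0, hqre⟩ := exists_entire_re_eq_normSq a N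
  have h := circleAverage_re_of_differentiable hq
  rw [hq0, Complex.ofReal_re] at h
  rw [← h]
  exact Real.circleAverage_congr_sphere fun z hz => (hqre z (by simpa using hz)).symm

/-- The average of a function against the conjugate of a polynomial. -/
theorem circleAverage_mul_conj_polynomial {g : ℂ → ℂ} (hg : ContinuousOn g (Metric.sphere 0 1))
    (a : ℕ → ℂ) (N : ℕ) :
    Real.circleAverage (fun z => g z * conj (∑ n ∈ Finset.range N, a n * z ^ n)) 0 1 =
      ∑ n ∈ Finset.range N, conj (a n) * Real.circleAverage (fun z => g z * conj z ^ n) 0 1 := by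
  simp_rw [← smul_eq_mul (conj (a _)), ← Real.circleAverage_fun_smul]
  rw [← Real.circleAverage_fun_sum]
  · congr 1
    ext z
    rw [map_sum, Finset.mul_sum]
    refine Finset.sum_congr rfl fun n _ => ?_
    simp only [map_mul, map_pow, smul_eq_mul]
    ring
  · intro n _
    have hc : Continuous fun z : ℂ => conj z ^ n := Complex.continuous_conj.pow n
    exact circleIntegrable_of_continuousOn_sphere (by fun_prop)

/-- Bessel's inequality on the unit circle. -/
theorem sum_norm_sq_circleAverage_le {g : ℂ → ℂ} (hg : ContinuousOn g (Metric.sphere 0 1))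
    (N : ℕ) :
    ∑ n ∈ Finset.range N, ‖Real.circleAverage (fun z => g z * conj z ^ n) 0 1‖ ^ 2 ≤
      Real.circleAverage (fun z => ‖g z‖ ^ 2) 0 1 := by
  set b : ℕ → ℂ := fun n => Real.circleAverage (fun z => g z * conj z ^ n) 0 1 with hb
  set P : ℂ → ℂ := fun z => ∑ n ∈ Finset.range N, b n * z ^ n with hP
  have hPc : Continuous P := by fun_prop
  have hPo : ContinuousOn P (Metric.sphere 0 1) := hPc.continuousOn
  have hcross : Real.circleAverage (fun z => (g z * conj (P z)).re) 0 1 =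
      ∑ n ∈ Finset.range N, ‖b n‖ ^ 2 := by
    have h1 := circleAverage_mul_conj_polynomial hg b N
    have h2 : Real.circleAverage (fun z => (g z * conj (P z)).re) 0 1 =
        (Real.circleAverage (fun z => g z * conj (P z)) 0 1).re :=
      Complex.reCLM.circleAverage_comp_comm (circleIntegrable_of_continuousOn_sphere
        (hg.mul (Complex.continuous_conj.comp_continuousOn hPo)))
    rw [h2, h1, Complex.re_sum]
    refine Finset.sum_congr rfl fun n _ => ?_
    rw [Complex.conj_mul']
    norm_cast
  have hc : ContinuousOn (fun z => (g z * conj (P z)).re) (Metric.sphere 0 1) :=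
    Complex.continuous_re.comp_continuousOn
      (hg.mul (Complex.continuous_conj.comp_continuousOn hPo))
  -- This is the average of `0 ≤ |g - P|²`, where `P` is the Fourier partial sum of `g`.
  have hmono : Real.circleAverage (fun z => (2 : ℝ) • (g z * conj (P z)).re - ‖P z‖ ^ 2) 0 1 ≤
      Real.circleAverage (fun z => ‖g z‖ ^ 2) 0 1 := by
    refine Real.circleAverage_mono
      (circleIntegrable_of_continuousOn_sphere (by fun_prop))
      (circleIntegrable_of_continuousOn_sphere (hg.norm.pow 2)) fun z _ => ?_
    have := Complex.normSq_sub (g z) (P z)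
    have h0 := Complex.normSq_nonneg (g z - P z)
    simp only [Complex.normSq_eq_norm_sq] at this h0
    simp only [smul_eq_mul]
    linarith
  rw [Real.circleAverage_fun_sub (circleIntegrable_of_continuousOn_sphere (by fun_prop))
    (circleIntegrable_of_continuousOn_sphere (by fun_prop)), Real.circleAverage_fun_smul,
    hcross, circleAverage_norm_sq_polynomial, smul_eq_mul] at hmono
  linarith

/-! ### Choice of signs: `L⁴` against `L²` -/

/-- The left side equals `2 (|A|² + |B|²)² + 8 (Re A conj B)²`; Cauchy–Schwarz on the last term
gives the middle coefficient `4 + 8 = 12`. -/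
theorem norm_add_pow_four_add_norm_sub_pow_four_le (A B : ℂ) :
    ‖A + B‖ ^ 4 + ‖A - B‖ ^ 4 ≤ 2 * ‖A‖ ^ 4 + 12 * ‖B‖ ^ 2 * ‖A‖ ^ 2 + 2 * ‖B‖ ^ 4 := by
  have h1 := Complex.normSq_add A B
  have h2 := Complex.normSq_sub A B
  have h3 : (A * conj B).re ^ 2 ≤ ‖A‖ ^ 2 * ‖B‖ ^ 2 := by
    rw [← mul_pow, ← Complex.norm_conj B, ← norm_mul]
    exact sq_le_sq' (by linarith [neg_abs_le (A * conj B).re, Complex.abs_re_le_norm (A * conj B)])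
      (Complex.re_le_norm _)
  simp only [Complex.normSq_eq_norm_sq] at h1 h2
  rw [show ‖A + B‖ ^ 4 = (‖A + B‖ ^ 2) ^ 2 by ring, show ‖A - B‖ ^ 4 = (‖A - B‖ ^ 2) ^ 2 by ring,
    h1, h2]
  nlinarith

/-- Every polynomial has a change of signs of its coefficients after which its `L⁴`-norm is
controlled by its `L²`-norm. -/
theorem exists_signs_circleAverage_norm_pow_four_le (a : ℕ → ℂ) (N : ℕ) :
    ∃ s : ℕ → ℂ, (∀ n, s n = 1 ∨ s n = -1) ∧
      Real.circleAverage (fun z => ‖∑ n ∈ Finset.range N, s n * a n * z ^ n‖ ^ 4) 0 1 ≤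
        3 * (∑ n ∈ Finset.range N, ‖a n‖ ^ 2) ^ 2 := by
  induction N with
  | zero => exact ⟨fun _ => 1, fun _ => Or.inl rfl, by simp [Real.circleAverage_const]⟩
  | succ N ih =>
    obtain ⟨s, hs, hle⟩ := ih
    set S := ∑ n ∈ Finset.range N, ‖a n‖ ^ 2 with hS
    set A : ℂ → ℂ := fun z => ∑ n ∈ Finset.range N, s n * a n * z ^ n with hA
    have hAc : Continuous A := by fun_prop
    have hA2 : Real.circleAverage (fun z => ‖A z‖ ^ 2) 0 1 = S := by
      rw [hS, hA, circleAverage_norm_sq_polynomial]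
      refine Finset.sum_congr rfl fun n _ => ?_
      rcases hs n with h | h <;> simp [h]
    have hint : ∀ {f : ℂ → ℝ}, Continuous f → CircleIntegrable f 0 1 := fun hf =>
      circleIntegrable_of_continuousOn_sphere hf.continuousOn
    -- With `b = ‖a N‖ ^ 2`, the induction hypothesis bounds the sum by `6 S² + 12 b S + 2 b²`,
    -- which is at most `6 (S + b)²`.
    have hsum : Real.circleAverage (fun z => ‖A z + a N * z ^ N‖ ^ 4) 0 1 +
        Real.circleAverage (fun z => ‖A z - a N * z ^ N‖ ^ 4) 0 1 ≤
        2 * (3 * (S + ‖a N‖ ^ 2) ^ 2) := by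
      rw [← Real.circleAverage_fun_add (hint (by fun_prop)) (hint (by fun_prop))]
      calc _ ≤ Real.circleAverage (fun z => (2 : ℝ) • ‖A z‖ ^ 4 +
              (12 * ‖a N‖ ^ 2) • ‖A z‖ ^ 2 + 2 * ‖a N‖ ^ 4) 0 1 := by
            refine Real.circleAverage_mono (hint (by fun_prop)) (hint (by fun_prop)) fun z hz => ?_
            have hz1 : ‖z‖ = 1 := by simpa using hz
            have := norm_add_pow_four_add_norm_sub_pow_four_le (A z) (a N * z ^ N)
            simpa [hz1] using this
        _ = 2 * Real.circleAverage (fun z => ‖A z‖ ^ 4) 0 1 + 12 * ‖a N‖ ^ 2 * S +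
              2 * ‖a N‖ ^ 4 := by
            rw [Real.circleAverage_fun_add (hint (by fun_prop)) (hint (by fun_prop)),
              Real.circleAverage_fun_add (hint (by fun_prop)) (hint (by fun_prop)),
              Real.circleAverage_fun_smul, Real.circleAverage_fun_smul,
              Real.circleAverage_const, hA2, smul_eq_mul, smul_eq_mul]
        _ ≤ _ := by nlinarith [sq_nonneg (‖a N‖ ^ 2)]
    -- The better of the two signs does at least as well as their mean.
    have key : ∃ e : ℂ, (e = 1 ∨ e = -1) ∧
        Real.circleAverage (fun z => ‖A z + e * a N * z ^ N‖ ^ 4) 0 1 ≤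
          3 * (S + ‖a N‖ ^ 2) ^ 2 := by
      by_cases h : Real.circleAverage (fun z => ‖A z + a N * z ^ N‖ ^ 4) 0 1 ≤
          3 * (S + ‖a N‖ ^ 2) ^ 2
      · exact ⟨1, Or.inl rfl, by simpa using h⟩
      · refine ⟨-1, Or.inr rfl, ?_⟩
        simp only [neg_mul, one_mul, ← sub_eq_add_neg]
        linarith
    obtain ⟨e, he, hle'⟩ := key
    refine ⟨Function.update s N e, fun n => ?_, ?_⟩
    · by_cases hn : n = N
      · subst hn; simpa using he
      · simpa [hn] using hs n
    · rw [Finset.sum_range_succ, ← hS]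
      convert hle' using 5 with z
      rw [Finset.sum_range_succ, Function.update_self]
      congr 1
      refine Finset.sum_congr rfl fun n hn => ?_
      rw [Function.update_of_ne (Finset.mem_range.1 hn).ne]

/-! ### Bounded analytic truncation of a polynomial -/

/-- An analytic truncation: a polynomial `G` with comparable `L⁴`- and `L²`-norms correlates with
a bounded analytic function `G / (1 + q)`, where `Re q` is a multiple of `|G|²` on the circle. -/
theorem exists_bounded_analytic_correlated (b : ℕ → ℂ) (N : ℕ) {S : ℝ} (hSpos : 0 < S)
    (hS : ∑ n ∈ Finset.range N, ‖b n‖ ^ 2 = S)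
    (h4 : Real.circleAverage (fun z => ‖∑ n ∈ Finset.range N, b n * z ^ n‖ ^ 4) 0 1 ≤ 3 * S ^ 2) :
    ∃ F : ℂ → ℂ, DiffContOnCl ℂ F (Metric.ball 0 1) ∧
      (∀ z ∈ Metric.closedBall (0 : ℂ) 1, ‖F z‖ ≤ 3 / 2 * √S) ∧
      S / 2 ≤ (Real.circleAverage
        (fun z => F z * conj (∑ n ∈ Finset.range N, b n * z ^ n)) 0 1).re := by
  obtain ⟨q, hq, hq0, hqre⟩ := exists_entire_re_eq_normSq b N
  have hG2 := circleAverage_norm_sq_polynomial b N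
  set G : ℂ → ℂ := fun z => ∑ n ∈ Finset.range N, b n * z ^ n with hG
  have hGd : Differentiable ℂ G := by fun_prop
  have hGc := hGd.continuous
  have hqc := hq.continuous
  rw [hS] at hq0 hG2
  have hcl : closure (Metric.ball (0 : ℂ) 1) = Metric.closedBall 0 1 :=
    closure_ball 0 one_ne_zero
  have hfr : frontier (Metric.ball (0 : ℂ) 1) = Metric.sphere 0 1 := frontier_ball 0 one_ne_zero
  -- The maximum principle for `exp (-q)`, of modulus `exp (-Re q) ≤ 1` on the circle.
  have hqnonneg : ∀ z ∈ Metric.closedBall (0 : ℂ) 1, 0 ≤ (q z).re := by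
    intro z hz
    have h := Complex.norm_le_of_forall_mem_frontier_norm_le (f := fun z => Complex.exp (-q z))
      (C := 1) Metric.isBounded_ball (hq.neg.cexp.diffContOnCl (s := Metric.ball 0 1)) ?_
      (hcl ▸ hz)
    · rw [Complex.norm_exp, Real.exp_le_one_iff] at h
      simpa using h
    · intro w hw
      rw [hfr] at hw
      rw [Complex.norm_exp, Real.exp_le_one_iff, Complex.neg_re, hqre w (by simpa using hw)]
      nlinarith [sq_nonneg ‖G w‖]
  -- Chosen so that the error `ε / 2 * (3 S² + 6 S²)` in the correlation is exactly `S / 2`.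
  set ε : ℝ := 1 / (9 * S) with hε
  have hεpos : 0 < ε := by positivity
  set D : ℂ → ℂ := fun z => 1 + (ε : ℂ) * q z with hD
  have hDd : Differentiable ℂ D := by fun_prop
  have hDre : ∀ z, (D z).re = 1 + ε * (q z).re := fun z => by simp [hD]
  have hD1 : ∀ z ∈ Metric.closedBall (0 : ℂ) 1, 1 ≤ ‖D z‖ := fun z hz => by
    have := Complex.re_le_norm (D z)
    have := mul_nonneg hεpos.le (hqnonneg z hz)
    linarith [hDre z]
  have hD0 : ∀ z ∈ Metric.closedBall (0 : ℂ) 1, D z ≠ 0 := fun z hz h => by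
    have := hD1 z hz
    rw [h, norm_zero] at this
    linarith
  have hFd : DiffContOnCl ℂ (fun z => G z / D z) (Metric.ball 0 1) := by
    refine DifferentiableOn.diffContOnCl fun z hz => ?_
    rw [hcl] at hz
    exact ((hGd z).div (hDd z) (hD0 z hz)).differentiableWithinAt
  have hsub : Metric.sphere (0 : ℂ) 1 ⊆ Metric.closedBall 0 1 := Metric.sphere_subset_closedBall
  have hFc : ContinuousOn (fun z => G z / D z) (Metric.sphere 0 1) :=
    hGc.continuousOn.div hDd.continuous.continuousOn fun z hz => hD0 z (hsub hz)
  refine ⟨fun z => G z / D z, hFd, fun z hz => ?_, ?_⟩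
  · refine Complex.norm_le_of_forall_mem_frontier_norm_le Metric.isBounded_ball hFd ?_ (hcl ▸ hz)
    intro w hw
    rw [hfr] at hw
    have hw0 := hD1 w (hsub hw)
    rw [norm_div, div_le_iff₀ (by linarith)]
    have h1 : 1 + ε * ‖G w‖ ^ 2 ≤ ‖D w‖ := by
      rw [← hqre w (by simpa using hw), ← hDre]
      exact Complex.re_le_norm _
    have ht : 0 < √S := Real.sqrt_pos.2 hSpos
    have ht2 : √S ^ 2 = S := Real.sq_sqrt hSpos.le
    -- By AM-GM, `x / (1 + ε x²) ≤ 1 / (2 √ε) = 3 √S / 2`.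
    have h2 : ‖G w‖ ≤ 3 / 2 * √S * (1 + ε * ‖G w‖ ^ 2) := by
      have hε' : ε = 1 / (9 * √S ^ 2) := by rw [ht2]
      rw [hε', show 3 / 2 * √S * (1 + 1 / (9 * √S ^ 2) * ‖G w‖ ^ 2) =
        (9 * √S ^ 2 + ‖G w‖ ^ 2) / (6 * √S) by field_simp; ring, le_div_iff₀ (by positivity)]
      nlinarith [sq_nonneg (3 * √S - ‖G w‖)]
    exact h2.trans (by gcongr)
  · have hint : ∀ {f : ℂ → ℝ}, Continuous f → CircleIntegrable f 0 1 := fun hf =>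
      circleIntegrable_of_continuousOn_sphere hf.continuousOn
    have hcc : ContinuousOn (fun z => G z / D z * conj (G z)) (Metric.sphere 0 1) :=
      hFc.mul (Complex.continuous_conj.comp hGc).continuousOn
    have hre : Real.circleAverage (fun z => (G z / D z * conj (G z)).re) 0 1 =
        (Real.circleAverage (fun z => G z / D z * conj (G z)) 0 1).re :=
      Complex.reCLM.circleAverage_comp_comm (circleIntegrable_of_continuousOn_sphere hcc)
    -- Use `|q|² = 2 (Re q)² - Re q²`: the mean of `Re q²` is `q(0)² = S²`, and `(Re q)² = |G|⁴` on
    -- the circle.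
    have hq2 : Real.circleAverage (fun z => ‖q z‖ ^ 2) 0 1 ≤ 6 * S ^ 2 := by
      have h1 : Real.circleAverage (fun z => ‖q z‖ ^ 2) 0 1 =
          Real.circleAverage (fun z => (2 : ℝ) • ‖G z‖ ^ 4 - (q z ^ 2).re) 0 1 := by
        refine Real.circleAverage_congr_sphere fun z hz => ?_
        have := hqre z (by simpa using hz)
        simp only [smul_eq_mul]
        rw [show ‖G z‖ ^ 4 = (‖G z‖ ^ 2) ^ 2 by ring, ← this, ← Complex.normSq_eq_norm_sq,
          Complex.normSq_apply, pow_two (q z), Complex.mul_re]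
        ring
      have h2 := circleAverage_re_of_differentiable (hq.pow 2)
      simp only [Pi.pow_apply] at h2
      rw [h1, Real.circleAverage_fun_sub (hint (by fun_prop)) (hint (by fun_prop)),
        Real.circleAverage_fun_smul, h2, hq0, ← Complex.ofReal_pow, Complex.ofReal_re, smul_eq_mul]
      nlinarith [sq_nonneg S]
    have hmono : Real.circleAverage (fun z => ‖G z‖ ^ 2 -
        (ε / 2) • (‖G z‖ ^ 4 + ‖q z‖ ^ 2)) 0 1 ≤
        Real.circleAverage (fun z => (G z / D z * conj (G z)).re) 0 1 := by
      refine Real.circleAverage_mono (hint (by fun_prop)) (circleIntegrable_of_continuousOn_sphere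
        (Complex.continuous_re.comp_continuousOn hcc)) fun z hz => ?_
      have hz' : z ∈ Metric.closedBall (0 : ℂ) 1 := hsub (by simpa using hz)
      have h0 := hD0 z hz'
      -- Since `1 / D = 1 - ε q / D` and `|D| ≥ 1`, the loss is at most `ε |G|² |q| ≤ (ε / 2) (|G|⁴
      -- + |q|²)`.
      have e1 : G z / D z * conj (G z) = ((‖G z‖ ^ 2 : ℝ) : ℂ) * (1 - ε * q z / D z) := by
        rw [div_mul_eq_mul_div, Complex.mul_conj, Complex.normSq_eq_norm_sq]
        field_simp
        simp only [hD]
        ring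
      have e2 : ‖(ε : ℂ) * q z / D z‖ ≤ ε * ‖q z‖ := by
        rw [norm_div, norm_mul, Complex.norm_real, Real.norm_of_nonneg hεpos.le]
        exact div_le_self (by positivity) (hD1 z hz')
      rw [e1, Complex.re_ofReal_mul, Complex.sub_re, Complex.one_re, smul_eq_mul]
      have e3 := (Complex.re_le_norm _).trans e2
      have e4 : ‖G z‖ ^ 2 * ((ε : ℂ) * q z / D z).re ≤ ‖G z‖ ^ 2 * (ε * ‖q z‖) := by gcongr
      nlinarith [mul_nonneg hεpos.le (sq_nonneg (‖G z‖ ^ 2 - ‖q z‖))]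
    rw [Real.circleAverage_fun_sub (hint (by fun_prop)) (hint (by fun_prop)),
      Real.circleAverage_fun_smul, Real.circleAverage_fun_add (hint (by fun_prop))
      (hint (by fun_prop)), hG2, smul_eq_mul] at hmono
    rw [← hre]
    refine le_trans ?_ hmono
    have h5 : ε / 2 * (Real.circleAverage (fun z => ‖G z‖ ^ 4) 0 1 +
        Real.circleAverage (fun z => ‖q z‖ ^ 2) 0 1) ≤ ε / 2 * (9 * S ^ 2) := by
      gcongr
      linarith
    have h6 : ε / 2 * (9 * S ^ 2) = S / 2 := by rw [hε]; field_simp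
    linarith

/-! ### Taylor coefficients and Hardy norms -/

theorem HolDisk.differentiableOn (f : HolDisk) :
    DifferentiableOn ℂ (f : ℂ → ℂ) (Metric.ball 0 1) := f.2.1

theorem HolDisk.contDiffAt_zero (f : HolDisk) (n : ℕ) : ContDiffAt ℂ n (f : ℂ → ℂ) 0 :=
  ((HolDisk.differentiableOn f).analyticAt (Metric.ball_mem_nhds 0 one_pos)).contDiffAt

/-- The Taylor coefficient sequence as a linear map. -/
noncomputable def taylorCoeffLinear : HolDisk →ₗ[ℂ] (ℕ → ℂ) where
  toFun := taylorCoeff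
  map_add' f g := by
    ext n
    simp only [taylorCoeff, Submodule.coe_add, Pi.add_apply]
    rw [iteratedDeriv_add (HolDisk.contDiffAt_zero f n) (HolDisk.contDiffAt_zero g n), add_div]
  map_smul' c f := by
    ext n
    simp only [taylorCoeff, Submodule.coe_smul, Pi.smul_apply, RingHom.id_apply]
    rw [iteratedDeriv_const_smul (HolDisk.contDiffAt_zero f n), smul_div_assoc]

theorem integral_circleMeasure (g : ℝ → ℝ) :
    ∫ t, g t ∂circleMeasure = (2 * Real.pi)⁻¹ * ∫ t in (0 : ℝ)..(2 * Real.pi), g t := by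
  rw [circleMeasure, MeasureTheory.integral_smul_measure,
    ENNReal.toReal_ofReal (by positivity), intervalIntegral.integral_of_le Real.two_pi_pos.le,
    MeasureTheory.integral_Icc_eq_integral_Ioc, smul_eq_mul]

instance : MeasureTheory.IsFiniteMeasure circleMeasure := by
  constructor
  simp [circleMeasure, ENNReal.mul_lt_top_iff]

/-- The `L²`-norm on a circle inside the disk, as an average over the unit circle. -/
theorem toReal_eLpNorm_two_sq (f : HolDisk) {r : ℝ} (hr : r ∈ Set.Ico (0 : ℝ) 1) :
    (MeasureTheory.eLpNorm (fun t : ℝ => (f : ℂ → ℂ) ((r : ℂ) * Complex.exp ((t : ℂ) * Complex.I)))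
      2 circleMeasure).toReal ^ 2 =
      Real.circleAverage (fun z => ‖(f : ℂ → ℂ) (r * z)‖ ^ 2) 0 1 := by
  set g : ℝ → ℂ := fun t => (f : ℂ → ℂ) ((r : ℂ) * Complex.exp ((t : ℂ) * Complex.I)) with hg
  have hmem : ∀ t : ℝ, (r : ℂ) * Complex.exp ((t : ℂ) * Complex.I) ∈ Metric.closedBall (0 : ℂ) r :=
    fun t => by simp [Complex.norm_exp_ofReal_mul_I, abs_of_nonneg hr.1]
  have hsub : Metric.closedBall (0 : ℂ) r ⊆ Metric.ball 0 1 := Metric.closedBall_subset_ball hr.2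
  have hfc : ContinuousOn (f : ℂ → ℂ) (Metric.closedBall 0 r) :=
    (HolDisk.differentiableOn f).continuousOn.mono hsub
  have hgc : Continuous g := hfc.comp_continuous (by fun_prop) hmem
  obtain ⟨C, hC⟩ := (isCompact_closedBall (0 : ℂ) r).exists_bound_of_continuousOn hfc
  have hLp : MeasureTheory.MemLp g 2 circleMeasure :=
    MeasureTheory.MemLp.of_bound hgc.aestronglyMeasurable C (.of_forall fun t => hC _ (hmem t))
  rw [hLp.eLpNorm_eq_integral_rpow_norm (by simp) (by simp),
    ENNReal.toReal_ofReal (by positivity), ← Real.rpow_natCast, ← Real.rpow_mul (by positivity)]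
  simp only [ENNReal.toReal_ofNat, Nat.cast_ofNat, Real.rpow_ofNat]
  rw [inv_mul_cancel₀ two_ne_zero, Real.rpow_one, integral_circleMeasure, Real.circleAverage_def,
    smul_eq_mul]
  simp [hg, circleMap]

/-- The Taylor coefficients of a function in `H₂` are square summable. -/
theorem sum_norm_sq_taylorCoeff_le (f : HolDisk) (hf : MemHardy 2 f) (N : ℕ) :
    ∑ n ∈ Finset.range N, ‖taylorCoeff f n‖ ^ 2 ≤ (hardyNorm 2 f).toReal ^ 2 := by
  -- Bessel applies to the dilation `f (r z)`, continuous on the circle; the finite sum then passes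
  -- to the limit `r → 1`.
  have hr : ∀ r ∈ Set.Ioo (0 : ℝ) 1,
      ∑ n ∈ Finset.range N, ‖(r : ℂ) ^ n * taylorCoeff f n‖ ^ 2 ≤ (hardyNorm 2 f).toReal ^ 2 := by
    intro r hr
    have hr' : r ∈ Set.Ico (0 : ℝ) 1 := ⟨hr.1.le, hr.2⟩
    have hsub : Metric.closedBall (0 : ℂ) r ⊆ Metric.ball 0 1 := Metric.closedBall_subset_ball hr.2
    have hd : DiffContOnCl ℂ (f : ℂ → ℂ) (Metric.ball 0 r) :=
      DifferentiableOn.diffContOnCl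
        ((HolDisk.differentiableOn f).mono (Metric.closure_ball_subset_closedBall.trans hsub))
    have hc : ContinuousOn (fun z : ℂ => (f : ℂ → ℂ) (r * z)) (Metric.sphere 0 1) := by
      refine (HolDisk.differentiableOn f).continuousOn.comp (by fun_prop) fun z hz => ?_
      have hz1 : ‖z‖ = 1 := by simpa using hz
      simpa [hz1, abs_of_pos hr.1] using hr.2
    have h := sum_norm_sq_circleAverage_le hc N
    simp_rw [circleAverage_dilation_mul_conj_pow hr.1 hd] at h
    refine h.trans ?_
    rw [← toReal_eLpNorm_two_sq f hr']
    gcongr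
    · exact hf.ne
    · exact le_iSup₂_of_le r hr' le_rfl
  have hcont : Continuous fun r : ℝ =>
      ∑ n ∈ Finset.range N, ‖(r : ℂ) ^ n * taylorCoeff f n‖ ^ 2 := by
    fun_prop
  have hlim := (hcont.tendsto 1).mono_left (nhdsWithin_le_nhds (s := Set.Iio 1))
  simp only [Complex.ofReal_one, one_pow, one_mul] at hlim
  exact le_of_tendsto hlim (Filter.eventually_of_mem (Ioo_mem_nhdsLT one_pos) hr)

theorem norm_taylorCoeff_le (f : HolDisk) (hf : MemHardy 2 f) (n : ℕ) :
    ‖taylorCoeff f n‖ ≤ (hardyNorm 2 f).toReal := by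
  refine le_of_sq_le_sq ?_ ENNReal.toReal_nonneg
  refine le_trans ?_ (sum_norm_sq_taylorCoeff_le f hf (n + 1))
  exact Finset.single_le_sum (f := fun n => ‖taylorCoeff f n‖ ^ 2) (fun _ _ => by positivity)
    (Finset.self_mem_range_succ n)

theorem hardyNorm_top_le (f : HolDisk) {M : ℝ}
    (hM : ∀ z ∈ Metric.ball (0 : ℂ) 1, ‖(f : ℂ → ℂ) z‖ ≤ M) :
    hardyNorm ∞ f ≤ ENNReal.ofReal M := by
  refine iSup₂_le fun r hr => ?_
  rw [MeasureTheory.eLpNorm_exponent_top]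
  refine MeasureTheory.eLpNormEssSup_le_of_ae_bound (.of_forall fun t => hM _ ?_)
  simpa [Complex.norm_exp_ofReal_mul_I, abs_of_nonneg hr.1] using hr.2

/-- A function differentiable on the disk, as an element of `HolDisk`. -/
theorem exists_holDisk_eqOn {F : ℂ → ℂ} (hF : DifferentiableOn ℂ F (Metric.ball 0 1)) :
    ∃ f : HolDisk, Set.EqOn (f : ℂ → ℂ) F (Metric.ball 0 1) := by
  have h : Set.EqOn ((Metric.ball (0 : ℂ) 1).indicator F) F (Metric.ball 0 1) :=
    Set.eqOn_indicator
  exact ⟨⟨(Metric.ball (0 : ℂ) 1).indicator F, hF.congr h,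
    fun z hz => Set.indicator_of_notMem hz F⟩, h⟩

/-- After a change of signs, every finitely supported sequence is correlated with the Taylor
coefficients of a bounded analytic function. -/
theorem exists_signs_holDisk_correlated (a : ℕ → ℂ) (N : ℕ) {S : ℝ} (hSpos : 0 < S)
    (hS : ∑ n ∈ Finset.range N, ‖a n‖ ^ 2 = S) :
    ∃ s : ℕ → ℂ, (∀ n, s n = 1 ∨ s n = -1) ∧ ∃ f : HolDisk,
      hardyNorm ∞ f ≤ ENNReal.ofReal (3 / 2 * √S) ∧
      S / 2 ≤ (∑ n ∈ Finset.range N, conj (s n * a n) * taylorCoeff f n).re := by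
  obtain ⟨s, hs, h4⟩ := exists_signs_circleAverage_norm_pow_four_le a N
  have hS' : ∑ n ∈ Finset.range N, ‖s n * a n‖ ^ 2 = S := by
    rw [← hS]
    refine Finset.sum_congr rfl fun n _ => ?_
    rcases hs n with h | h <;> simp [h]
  rw [hS] at h4
  obtain ⟨F, hFd, hFM, hFS⟩ :=
    exists_bounded_analytic_correlated (fun n => s n * a n) N hSpos hS' h4
  obtain ⟨f, hf⟩ := exists_holDisk_eqOn hFd.differentiableOn
  refine ⟨s, hs, f, hardyNorm_top_le f fun z hz => ?_, ?_⟩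
  · rw [hf hz]
    exact hFM z (Metric.ball_subset_closedBall hz)
  · have hFc : ContinuousOn F (Metric.sphere 0 1) :=
      hFd.continuousOn_ball.mono Metric.sphere_subset_closedBall
    rw [circleAverage_mul_conj_polynomial hFc] at hFS
    convert hFS using 4 with n
    have h := circleAverage_dilation_mul_conj_pow one_pos hFd n
    simp only [Complex.ofReal_one, one_mul, one_pow] at h
    rw [h, taylorCoeff]
    congr 1
    exact (hf.eventuallyEq_of_mem (Metric.ball_mem_nhds 0 one_pos)).iteratedDeriv_eq n

/-- The `n`-th Taylor coefficient is not identically zero on `H_∞`. -/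
theorem exists_memHardy_top_taylorCoeff_ne_zero (n : ℕ) :
    ∃ f : HolDisk, MemHardy ∞ f ∧ taylorCoeff f n ≠ 0 := by
  have hS : ∑ k ∈ Finset.range (n + 1), ‖(Pi.single n 1 : ℕ → ℂ) k‖ ^ 2 = 1 := by
    rw [Finset.sum_eq_single n] <;> simp +contextual
  obtain ⟨s, -, f, hf, hle⟩ := exists_signs_holDisk_correlated _ _ one_pos hS
  refine ⟨f, hf.trans_lt ENNReal.ofReal_lt_top, fun h0 => ?_⟩
  -- Were the coefficient zero, the whole correlation would vanish, although it is at least `1 / 2`.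
  rw [Finset.sum_eq_zero] at hle
  · norm_num at hle
  · intro k _
    by_cases hk : k = n
    · rw [hk, h0, mul_zero]
    · simp [hk]

/-! ### Banach sequence lattices -/

namespace BanachSequenceLattice

variable (T : BanachSequenceLattice)

/-- A lattice with an element whose `n`-th term is nonzero contains the `n`-th unit sequence. -/
theorem exists_toSeq_eq_single {n : ℕ} {x : T.E} (hx : T.toSeq x n ≠ 0) :
    ∃ e : T.E, T.toSeq e = Pi.single n 1 := by
  obtain ⟨e, he, -⟩ := T.ideal ((T.toSeq x n)⁻¹ • x) (Pi.single n 1) fun k => by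
    by_cases hk : k = n
    · subst hk; simp [hx]
    · rw [Pi.single_eq_of_ne hk, norm_zero]
      exact norm_nonneg _
  exact ⟨e, he⟩

/-- The coordinate functionals of a Banach sequence lattice are bounded. -/
theorem exists_norm_toSeq_le (n : ℕ) : ∃ C : ℝ, ∀ y : T.E, ‖T.toSeq y n‖ ≤ C * ‖y‖ := by
  by_cases h : ∃ x : T.E, T.toSeq x n ≠ 0
  · obtain ⟨x, hx⟩ := h
    obtain ⟨e, he⟩ := T.exists_toSeq_eq_single hx
    have he0 : 0 < ‖e‖ := by
      refine norm_pos_iff.2 fun h0 => ?_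
      have := congrFun he n
      simp [h0] at this
    refine ⟨‖e‖⁻¹, fun y => ?_⟩
    -- Solidity: `y_n e` is dominated termwise by `y`, so `|y_n| ‖e‖ ≤ ‖y‖`.
    obtain ⟨y', hy', hle⟩ := T.ideal y (Pi.single n (T.toSeq y n)) fun k => by
      by_cases hk : k = n
      · subst hk; simp
      · simp [hk]
    have : y' = T.toSeq y n • e := T.toSeq_injective <| by
      rw [hy', map_smul, he]
      ext k
      simp [Pi.single_apply]
    rw [this, norm_smul] at hle
    rw [inv_mul_eq_div, le_div_iff₀ he0]
    exact hle
  · push Not at h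
    exact ⟨0, fun y => by simp [h y]⟩

theorem continuous_toSeq_apply (n : ℕ) : Continuous fun y : T.E => T.toSeq y n := by
  obtain ⟨C, hC⟩ := T.exists_norm_toSeq_le n
  exact (LinearMap.mkContinuous ((LinearMap.proj n).comp T.toSeq) C hC).continuous

/-- A linear map with values in a Banach sequence lattice is bounded as soon as its coordinates
are. -/
theorem exists_bounded_lift {X : Type*} [NormedAddCommGroup X] [NormedSpace ℂ X] [CompleteSpace X]
    (u : X →ₗ[ℂ] (ℕ → ℂ)) (hu : ∀ x, u x ∈ T.seqs) (huc : ∀ n, Continuous fun x => u x n) :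
    ∃ Φ : X →L[ℂ] T.E, ∀ x, T.toSeq (Φ x) = u x := by
  choose g hg using hu
  let Φ : X →ₗ[ℂ] T.E :=
    { toFun := g
      map_add' := fun x y => T.toSeq_injective (by simp [hg])
      map_smul' := fun c x => T.toSeq_injective (by simp [hg]) }
  refine ⟨ContinuousLinearMap.ofSeqClosedGraph (g := Φ) fun v x y hv hy => ?_, hg⟩
  refine T.toSeq_injective (funext fun n => ?_)
  have h1 := ((T.continuous_toSeq_apply n).tendsto y).comp hy
  have h2 := ((huc n).tendsto x).comp hv
  have h3 : (fun y : T.E => T.toSeq y n) ∘ Φ ∘ v = (fun x => u x n) ∘ v := by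
    ext k
    exact congrFun (hg (v k)) n
  rw [h3] at h1
  exact (tendsto_nhds_unique h1 h2).trans (congrFun (hg x) n).symm

/-- In a lattice containing the coefficients of `H_∞`, with bounded inclusion, functionals have
square summable values on the unit sequences. -/
theorem sqrt_sum_norm_sq_dual_le {C : ℝ} (hC : 0 ≤ C)
    (hT : ∀ f : HolDisk, MemHardy ∞ f →
      ∃ y : T.E, T.toSeq y = taylorCoeff f ∧ ‖y‖ ≤ C * (hardyNorm ∞ f).toReal)
    {e : ℕ → T.E} (he : ∀ n, T.toSeq (e n) = Pi.single n 1) (φ : StrongDual ℂ T.E) (hφ : ‖φ‖ ≤ 1)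
    (N : ℕ) : √(∑ n ∈ Finset.range N, ‖φ (e n)‖ ^ 2) ≤ 3 * C := by
  set S := ∑ n ∈ Finset.range N, ‖φ (e n)‖ ^ 2 with hS
  have hS0 : 0 ≤ S := by positivity
  rcases hS0.eq_or_lt with h0 | hpos
  · rw [← h0, Real.sqrt_zero]
    positivity
  obtain ⟨s, hs, f, hf, hle⟩ := exists_signs_holDisk_correlated (fun n => conj (φ (e n))) N hpos
    (by simp [hS])
  obtain ⟨y, hy, hyle⟩ := hT f (hf.trans_lt ENNReal.ofReal_lt_top)
  -- Solidity absorbs both the signs and the truncation to `n < N`, and `φ v` is then exactly the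
  -- correlation bounded below.
  obtain ⟨v, hv, hvle⟩ := T.ideal y
      (fun k => if k ∈ Finset.range N then s k * taylorCoeff f k else 0) fun k => by
    rw [hy]
    split_ifs
    · rcases hs k with h | h <;> simp [h]
    · simp
  have hvsum : v = ∑ n ∈ Finset.range N, (s n * taylorCoeff f n) • e n := by
    refine T.toSeq_injective ?_
    rw [hv, map_sum]
    ext k
    simp [he, Finset.sum_apply, Pi.single_apply]
  have hφv : φ v = ∑ n ∈ Finset.range N, conj (s n * conj (φ (e n))) * taylorCoeff f n := by
    rw [hvsum, map_sum]
    refine Finset.sum_congr rfl fun n _ => ?_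
    rw [map_smul, smul_eq_mul, map_mul, Complex.conj_conj]
    rcases hs n with h | h <;> simp [h] <;> ring
  rw [← hφv] at hle
  have ht : 0 < √S := Real.sqrt_pos.2 hpos
  have h1 : (hardyNorm ∞ f).toReal ≤ 3 / 2 * √S :=
    ENNReal.toReal_le_of_le_ofReal (by positivity) hf
  have h2 : S / 2 ≤ C * (3 / 2 * √S) := calc
    S / 2 ≤ ‖φ v‖ := hle.trans (Complex.re_le_norm _)
    _ ≤ 1 * ‖v‖ := φ.le_of_opNorm_le hφ v
    _ ≤ C * (hardyNorm ∞ f).toReal := by rw [one_mul]; exact hvle.trans hyle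
    _ ≤ _ := by gcongr
  have h3 : √S * √S = S := Real.mul_self_sqrt hS0
  -- Cancelling `√S / 2` from `S / 2 ≤ (3 / 2) C √S`.
  nlinarith

/-- A norming functional turns the dual bound into this one by Cauchy–Schwarz. -/
theorem norm_sum_smul_single_le {C : ℝ} (hC : 0 ≤ C)
    (hT : ∀ f : HolDisk, MemHardy ∞ f →
      ∃ y : T.E, T.toSeq y = taylorCoeff f ∧ ‖y‖ ≤ C * (hardyNorm ∞ f).toReal)
    {e : ℕ → T.E} (he : ∀ n, T.toSeq (e n) = Pi.single n 1) (c : ℕ → ℂ) (t : Finset ℕ) :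
    ‖∑ n ∈ t, c n • e n‖ ≤ 3 * C * √(∑ n ∈ t, ‖c n‖ ^ 2) := by
  obtain ⟨φ, hφ, hφx⟩ := exists_dual_vector'' ℂ (∑ n ∈ t, c n • e n)
  obtain ⟨N, hN⟩ := t.exists_nat_subset_range
  have hw : √(∑ n ∈ t, ‖φ (e n)‖ ^ 2) ≤ 3 * C :=
    (Real.sqrt_le_sqrt (Finset.sum_le_sum_of_subset_of_nonneg hN fun _ _ _ => by positivity)).trans
      (T.sqrt_sum_norm_sq_dual_le hC hT he φ hφ N)
  calc ‖∑ n ∈ t, c n • e n‖ = ‖φ (∑ n ∈ t, c n • e n)‖ := by rw [hφx]; simp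
    _ = ‖∑ n ∈ t, c n * φ (e n)‖ := by simp [map_sum]
    _ ≤ ∑ n ∈ t, ‖c n‖ * ‖φ (e n)‖ := by
      refine (norm_sum_le _ _).trans_eq ?_
      simp
    _ ≤ √(∑ n ∈ t, ‖c n‖ ^ 2) * √(∑ n ∈ t, ‖φ (e n)‖ ^ 2) :=
      Real.sum_mul_le_sqrt_mul_sqrt _ _ _
    _ ≤ √(∑ n ∈ t, ‖c n‖ ^ 2) * (3 * C) := by gcongr
    _ = _ := mul_comm _ _

/-- A lattice in which the unit sequences satisfy an upper `ℓ₂`-estimate contains `ℓ₂`. -/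
theorem ellTwo_embedsInto_of_upper_estimate {K : ℝ} (hK : 0 ≤ K) {e : ℕ → T.E}
    (he : ∀ n, T.toSeq (e n) = Pi.single n 1)
    (hle : ∀ (c : ℕ → ℂ) (t : Finset ℕ), ‖∑ n ∈ t, c n • e n‖ ≤ K * √(∑ n ∈ t, ‖c n‖ ^ 2)) :
    ellTwo.EmbedsInto T := by
  refine ⟨⟨K, hK⟩, fun x => ?_⟩
  change lp (fun _ : ℕ => ℂ) 2 at x
  have hx : Summable fun n => ‖x n‖ ^ 2 := by
    simpa using (lp.memℓp x).summable (by simp)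
  have hsum : Summable fun n => x n • e n := by
    rw [summable_iff_vanishing_norm]
    intro ε hε
    -- `K + 1` in place of `K` allows `K = 0`.
    obtain ⟨s, hs⟩ := summable_iff_vanishing_norm.1 hx ((ε / (K + 1)) ^ 2) (by positivity)
    refine ⟨s, fun t ht => (hle _ t).trans_lt ?_⟩
    have h1 := (le_abs_self _).trans_lt (hs t ht)
    have h2 : √(∑ n ∈ t, ‖x n‖ ^ 2) < ε / (K + 1) := (Real.sqrt_lt' (by positivity)).2 h1
    rw [lt_div_iff₀ (by positivity)] at h2
    nlinarith [Real.sqrt_nonneg (∑ n ∈ t, ‖x n‖ ^ 2)]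
  refine ⟨∑' n, x n • e n, ?_, ?_⟩
  · ext k
    obtain ⟨C, hC⟩ := T.exists_norm_toSeq_le k
    have h := hsum.hasSum.mapL (LinearMap.mkContinuous ((LinearMap.proj k).comp T.toSeq) C hC)
    have h1 : ∀ n, T.toSeq (x n • e n) k = if n = k then x k else 0 := fun n => by
      by_cases hn : n = k
      · subst hn; simp [he]
      · simp [he, hn]
    have h2 := hasSum_ite_eq k (x k)
    simp_rw [← h1] at h2
    exact h.unique h2
  · refine le_of_tendsto hsum.hasSum.norm (.of_forall fun t => (hle _ t).trans ?_)
    refine mul_le_mul_of_nonneg_left ?_ hK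
    have := lp.sum_rpow_le_norm_rpow (p := 2) (by simp) x t
    simp only [ENNReal.toReal_ofNat, Real.rpow_ofNat] at this
    exact Real.sqrt_le_iff.2 ⟨norm_nonneg x, this⟩

end BanachSequenceLattice

/-! ### The coefficient space of `X` and its solid hull -/

theorem coeffSpace_range_subset_ellTwo {X : Type*} [NormedAddCommGroup X] [NormedSpace ℂ X]
    (ι : X →ₗ[ℂ] HolDisk) (htwo : EmbedsIntoHardy 2 ι) :
    coeffSpace (LinearMap.range ι) ⊆ BanachSequenceLattice.ellTwo.seqs := by
  obtain ⟨C, hC⟩ := htwo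
  rintro _ ⟨_, ⟨x, rfl⟩, rfl⟩
  have hs : Summable fun n => ‖taylorCoeff (ι x) n‖ ^ 2 :=
    summable_of_sum_range_le (fun _ => by positivity) (sum_norm_sq_taylorCoeff_le _ (hC x).1)
  exact ⟨⟨taylorCoeff (ι x), memℓp_gen (by simpa using hs)⟩, rfl⟩

/-- This supplies the coordinatewise continuity that the closed graph argument needs. -/
theorem continuous_taylorCoeff_of_embedsIntoHardy {X : Type*} [NormedAddCommGroup X]
    [NormedSpace ℂ X] (ι : X →ₗ[ℂ] HolDisk) (htwo : EmbedsIntoHardy 2 ι) (n : ℕ) :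
    Continuous fun x => taylorCoeff (ι x) n := by
  obtain ⟨C, hC⟩ := htwo
  let u : X →ₗ[ℂ] ℂ := (LinearMap.proj n).comp (taylorCoeffLinear.comp ι)
  refine (u.mkContinuous C fun x => ?_).continuous
  refine (norm_taylorCoeff_le (ι x) (hC x).1 n).trans ?_
  have h := ENNReal.toReal_mono (by finiteness) (hC x).2
  simpa using h

theorem mainTheorem4 {X : Type*} [NormedAddCommGroup X] [NormedSpace ℂ X] [CompleteSpace X]
    (ι : X →ₗ[ℂ] HolDisk) (hι : Function.Injective ι)
    (hinf : HardyEmbedsInto ∞ ι) (htwo : EmbedsIntoHardy 2 ι) :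
    BanachSequenceLattice.ellTwo.IsSolidHull (coeffSpace (LinearMap.range ι)) := by
  refine ⟨coeffSpace_range_subset_ellTwo ι htwo, fun T hT => ?_⟩
  obtain ⟨Φ, hΦ⟩ := T.exists_bounded_lift (taylorCoeffLinear.comp ι)
    (fun x => hT ⟨ι x, ⟨x, rfl⟩, rfl⟩) (continuous_taylorCoeff_of_embedsIntoHardy ι htwo)
  obtain ⟨C, hC⟩ := hinf
  have hbound : ∀ f : HolDisk, MemHardy ∞ f →
      ∃ y : T.E, T.toSeq y = taylorCoeff f ∧ ‖y‖ ≤ ‖Φ‖ * C * (hardyNorm ∞ f).toReal := by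
    intro f hf
    obtain ⟨x, rfl, hx⟩ := hC f hf
    refine ⟨Φ x, hΦ x, (Φ.le_opNorm x).trans ?_⟩
    rw [mul_assoc]
    gcongr
    have h := ENNReal.toReal_mono (ENNReal.mul_ne_top ENNReal.coe_ne_top hf.ne) hx
    simpa using h
  have hunit : ∀ n, ∃ e : T.E, T.toSeq e = Pi.single n 1 := by
    intro n
    obtain ⟨f, hf, hfn⟩ := exists_memHardy_top_taylorCoeff_ne_zero n
    obtain ⟨y, hy, -⟩ := hbound f hf
    exact T.exists_toSeq_eq_single (x := y) (by rwa [hy])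
  choose e he using hunit
  have hK : 0 ≤ ‖Φ‖ * C := by positivity
  exact T.ellTwo_embedsInto_of_upper_estimate (by positivity) he
    (T.norm_sum_smul_single_le hK hbound he)
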